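/- Let $k$ be an algebraically closed field, let $G$ be a connected reductive $k$-group (a Zariski-closed connected subgroup of some $\mathrm{GL}_{n,k}$ with trivial unipotent radical), let $T \subset G$ be a maximal torus, and let $(X^*(T), \Phi; X_*(T), \Phi^\vee)$ be the (reduced) root datum of $(G,T)$, with pairing $\langle\,,\rangle$ and Weyl group $W$. Suppose that $G$ is simple, i.e. that $\Phi$ is nonempty and irreducible (not the union of two nonempty mutually orthogonal subsets). A character $\chi \in X^*(T)$ is called * *quasi-constant* if $\langle \chi, w\alpha^\vee\rangle / \langle \chi, \alpha^\vee\rangle \in \{-1,0,1\}$ for all $w \in W$ and all $\alpha \in \Phi$ with $\langle \chi, \alpha^\vee\rangle \neq 0$; * *minuscule* if $\langle \chi, \alpha^\vee\rangle \in \{0,1,-1\}$ for all $\alpha \in \Phi$; * *cominuscule* (for $G$ semisimple) if there are a basis of simple roots $\Delta \subset \Phi$ and $\alpha \in \Delta$ such that $\chi$ is the fundamental weight $\eta(\alpha)$, i.e. $\langle \chi, \alpha^\vee\rangle = 1$ and $\langle \chi, \beta^\vee\rangle = 0$ for $\beta \in \Delta\setminus\{\alpha\}$, and such that the fundamental coweight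 $\eta(\alpha^\vee) \in X_*(T)_{\mathbf Q}$, defined by $\langle \alpha, \eta(\alpha^\vee)\rangle = 1$ and $\langle \beta, \eta(\alpha^\vee)\rangle = 0$ for $\beta \in \Delta\setminus\{\alpha\}$, is minuscule, i.e. $\langle \gamma, \eta(\alpha^\vee)\rangle \in \{0,1,-1\}$ for all $\gamma \in \Phi$. The same notions for cocharacters $\mu \in X_*(T)$ are obtained by exchanging roots with coroots and weights with coweights. 1. If $G$ is simply-connected (i.e. $\mathbf{Z}\Phi^\vee = X_*(T)$), then a character of $T$ is quasi-constant if and only if it is an integer multiple of a character of $T$ which is minuscule or cominuscule. 2. If $G$ is adjoint (i.e. $\mathbf{Z}\Phi = X^*(T)$), then a cocharacter of $T$ is quasi-constant if and only if it is an integer multiple of a cocharacter of $T$ which is minuscule or cominuscule. -/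

import Mathlib

open scoped TensorProduct

/-!
## Linear algebraic groups over a field, as Zariski-closed subgroups of `GL n`

Over an algebraically closed field `k`, smooth affine `k`-groups are the same thing as
Zariski-closed subgroups of the groups `GL (Fin n) k`.
-/

namespace LinAlgGroup

variable {k : Type*} [Field k] {n : ℕ}

/-- The value at `g` of a polynomial in the matrix entries. -/
noncomputable def evalEntries (g : GL (Fin n) k) (p : MvPolynomial (Fin n × Fin n) k) : k :=
  MvPolynomial.eval (fun ij => (g : Matrix (Fin n) (Fin n) k) ij.1 ij.2) p

/-- Zariski-closed subsets of `GL n`. -/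
def IsZariskiClosed (S : Set (GL (Fin n) k)) : Prop :=
  ∃ I : Set (MvPolynomial (Fin n × Fin n) k), S = {g | ∀ p ∈ I, evalEntries g p = 0}

/-- A subset of `GL n` is connected if it is not the union of two disjoint nonempty relatively
closed subsets. -/
def IsZariskiConnected (S : Set (GL (Fin n) k)) : Prop :=
  ∀ A B : Set (GL (Fin n) k), IsZariskiClosed A → IsZariskiClosed B →
    S ⊆ A ∪ B → S ∩ A ∩ B = ∅ → S ⊆ A ∨ S ⊆ B

/-- All elements are unipotent matrices. -/
def IsUnipotent (U : Subgroup (GL (Fin n) k)) : Prop :=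
  ∀ u ∈ U, IsNilpotent ((u : Matrix (Fin n) (Fin n) k) - 1)

/-- Connected reductive groups: closed connected subgroups of `GL n` whose only closed connected
normal unipotent subgroup is the trivial one. -/
structure IsConnectedReductive (G : Subgroup (GL (Fin n) k)) : Prop where
  isClosed : IsZariskiClosed (G : Set (GL (Fin n) k))
  isConnected : IsZariskiConnected (G : Set (GL (Fin n) k))
  unipotentRadical_eq_bot : ∀ U : Subgroup (GL (Fin n) k), U ≤ G →
    IsZariskiClosed (U : Set (GL (Fin n) k)) → IsZariskiConnected (U : Set (GL (Fin n) k)) →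
    (∀ g ∈ G, ∀ u ∈ U, g * u * g⁻¹ ∈ U) → IsUnipotent U → U = ⊥

/-- Tori (over an algebraically closed field): closed connected diagonalizable subgroups. -/
structure IsTorus (T : Subgroup (GL (Fin n) k)) : Prop where
  isClosed : IsZariskiClosed (T : Set (GL (Fin n) k))
  isConnected : IsZariskiConnected (T : Set (GL (Fin n) k))
  diagonalizable : ∃ g : GL (Fin n) k, ∀ t ∈ T,
    ((g * t * g⁻¹ : GL (Fin n) k) : Matrix (Fin n) (Fin n) k).IsDiag

/-- Maximal tori of `G`. -/
structure MaximalTorus (G : Subgroup (GL (Fin n) k)) where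
  /-- The underlying group. -/
  toSubgroup : Subgroup (GL (Fin n) k)
  le : toSubgroup ≤ G
  isTorus : IsTorus toSubgroup
  maximal : ∀ T' : Subgroup (GL (Fin n) k), T' ≤ G → IsTorus T' → toSubgroup ≤ T' →
    T' = toSubgroup

theorem IsTorus.mul_comm {T : Subgroup (GL (Fin n) k)} (hT : IsTorus T) (a b : T) :
    a * b = b * a := by
  obtain ⟨g, hg⟩ := hT.diagonalizable
  obtain ⟨a, ha⟩ := a
  obtain ⟨b, hb⟩ := b
  have key : (g * a * g⁻¹) * (g * b * g⁻¹) = (g * b * g⁻¹) * (g * a * g⁻¹) := by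
    apply Units.ext
    have ha' := hg a ha
    have hb' := hg b hb
    generalize g * a * g⁻¹ = x at ha' ⊢
    generalize g * b * g⁻¹ = y at hb' ⊢
    rw [Units.val_mul, Units.val_mul, ← ha'.diagonal_diag, ← hb'.diagonal_diag,
      Matrix.diagonal_mul_diagonal, Matrix.diagonal_mul_diagonal]
    congr 1
    funext i
    exact _root_.mul_comm _ _
  have h2 : g * (a * b) * g⁻¹ = g * (b * a) * g⁻¹ := by
    simpa [mul_assoc] using key
  exact Subtype.ext (mul_left_cancel (mul_right_cancel h2))

variable {G : Subgroup (GL (Fin n) k)}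

instance (T : MaximalTorus G) : CommGroup T.toSubgroup :=
  { (inferInstance : Group T.toSubgroup) with mul_comm := T.isTorus.mul_comm }

/-- A homomorphism `χ : T → k ˣ` is a morphism of varieties if `χ t` is a polynomial in the
entries of `t` and of `t⁻¹`. -/
def IsRegularChar (T : MaximalTorus G) (χ : T.toSubgroup →* kˣ) : Prop :=
  ∃ p : MvPolynomial ((Fin n × Fin n) ⊕ (Fin n × Fin n)) k, ∀ t : T.toSubgroup,
    (χ t : k) = MvPolynomial.eval
      (Sum.elim (fun ij => ((t : GL (Fin n) k) : Matrix (Fin n) (Fin n) k) ij.1 ij.2)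
        (fun ij => ((t⁻¹ : T.toSubgroup) : GL (Fin n) k).1 ij.1 ij.2)) p

/-- A homomorphism `μ : k ˣ → T` is a morphism of varieties if the entries of `μ x` are
polynomials in `x` and `x⁻¹`. -/
def IsRegularCochar (T : MaximalTorus G) (μ : kˣ →* T.toSubgroup) : Prop :=
  ∀ i j : Fin n, ∃ p : MvPolynomial (Fin 2) k, ∀ x : kˣ,
    ((μ x : GL (Fin n) k) : Matrix (Fin n) (Fin n) k) i j
      = MvPolynomial.eval ![(x : k), ((x⁻¹ : kˣ) : k)] p

/-- The characters of `T`, as a multiplicative group. -/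
def charSubgroup (T : MaximalTorus G) : Subgroup (T.toSubgroup →* kˣ) where
  carrier := {χ | IsRegularChar T χ}
  one_mem' := ⟨1, fun t => by simp⟩
  mul_mem' := by
    rintro χ ψ ⟨p, hp⟩ ⟨q, hq⟩
    exact ⟨p * q, fun t => by simp [hp, hq]⟩
  inv_mem' := by
    rintro χ ⟨p, hp⟩
    refine ⟨MvPolynomial.rename Sum.swap p, fun t => ?_⟩
    have h1 : (χ⁻¹) t = χ t⁻¹ := by simp
    rw [h1, hp, MvPolynomial.eval_rename]
    congr 2
    funext s
    rcases s with s | s <;> simp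

/-- The cocharacters of `T`, as a multiplicative group. -/
def cocharSubgroup (T : MaximalTorus G) : Subgroup (kˣ →* T.toSubgroup) where
  carrier := {μ | IsRegularCochar T μ}
  one_mem' := fun i j => ⟨MvPolynomial.C ((1 : Matrix (Fin n) (Fin n) k) i j), fun x => by simp⟩
  mul_mem' := by
    intro μ ν hμ hν i j
    choose p hp using hμ
    choose q hq using hν
    refine ⟨∑ l, p i l * q l j, fun x => ?_⟩
    simp [Matrix.mul_apply, hp, hq]
  inv_mem' := by
    intro μ hμ i j
    obtain ⟨p, hp⟩ := hμ i j
    refine ⟨MvPolynomial.rename (Equiv.swap 0 1) p, fun x => ?_⟩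
    have h1 : (μ⁻¹) x = μ x⁻¹ := by simp
    rw [h1, hp, MvPolynomial.eval_rename]
    congr 2
    funext s
    fin_cases s <;> simp

/-- The character group `X^*(T)`, written additively. -/
abbrev CharGroup (T : MaximalTorus G) : Type _ := Additive (charSubgroup T)

/-- The cocharacter group `X_*(T)`, written additively. -/
abbrev CocharGroup (T : MaximalTorus G) : Type _ := Additive (cocharSubgroup T)

/-- A character as a homomorphism `T → k ˣ`. -/
def CharGroup.hom {T : MaximalTorus G} (χ : CharGroup T) : T.toSubgroup →* kˣ :=
  (Additive.toMul χ : charSubgroup T).1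

/-- A cocharacter as a homomorphism `k ˣ → T`. -/
def CocharGroup.hom {T : MaximalTorus G} (μ : CocharGroup T) : kˣ →* T.toSubgroup :=
  (Additive.toMul μ : cocharSubgroup T).1

/-- `X` lies in the Lie algebra of `G` (the tangent space at `1`): the derivative at `1` in the
direction `X` of every polynomial vanishing on `G` is zero. -/
def MemLie (G : Subgroup (GL (Fin n) k)) (X : Matrix (Fin n) (Fin n) k) : Prop :=
  ∀ p : MvPolynomial (Fin n × Fin n) k, (∀ g ∈ G, evalEntries g p = 0) →
    ∑ ij : Fin n × Fin n, X ij.1 ij.2 * evalEntries 1 (MvPolynomial.pderiv ij p) = 0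

/-- The set `Φ(G, T)` of roots: the nonzero weights of the adjoint action of `T` on `Lie G`. -/
def roots (T : MaximalTorus G) : Set (CharGroup T) :=
  {α | α ≠ 0 ∧ ∃ X : Matrix (Fin n) (Fin n) k, X ≠ 0 ∧ MemLie G X ∧
    ∀ t : T.toSubgroup,
      ((t : GL (Fin n) k) : Matrix (Fin n) (Fin n) k) * X
          * ((t⁻¹ : T.toSubgroup) : GL (Fin n) k).1
        = (α.hom t : k) • X}

/-- `μ` is the coroot of `α`: one has `⟨α, μ⟩ = 2`, and the reflection
`t ↦ t * μ (α t)⁻¹` of `T` is conjugation by an element of `G`. -/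
def IsCoroot (T : MaximalTorus G) (α : CharGroup T) (μ : CocharGroup T) : Prop :=
  (∀ x : kˣ, α.hom (μ.hom x) = x ^ 2) ∧
  ∃ g ∈ G, ∀ t : T.toSubgroup,
    g * (t : GL (Fin n) k) * g⁻¹ = ((t * (μ.hom (α.hom t))⁻¹ : T.toSubgroup) : GL (Fin n) k)

/-- `P` is the (reduced) root datum `(X^*(T), Φ; X_*(T), Φ^∨)` of the pair `(G, T)`: its pairing is
`χ (μ x) = x ^ ⟨χ, μ⟩`, its roots are those of `T` in `G`, each with its own coroot. -/
structure IsRootDatum (T : MaximalTorus G)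
    (P : RootDatum (roots T) (CharGroup T) (CocharGroup T)) : Prop where
  pairing : ∀ (χ : CharGroup T) (μ : CocharGroup T) (x : kˣ),
    χ.hom (μ.hom x) = x ^ (P.toLinearMap χ μ)
  root : ∀ α : roots T, P.root α = α
  coroot : ∀ α : roots T, IsCoroot T α (P.coroot α)
  isReduced : P.IsReduced

end LinAlgGroup

/-!
## Characters of root data

Everything is stated for the weight lattice `X` of a root datum `P`. The notions for cocharacters
are those for the dual root datum `P.flip`.
-/

namespace RootDatum

variable {ι X Y : Type*} [AddCommGroup X] [AddCommGroup Y]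

/-- The root system is irreducible: nonempty, and not a union of two nonempty mutually orthogonal
subsets. For a semisimple group over an algebraically closed field, this says that the group is
simple. -/
def IsSimple (P : RootDatum ι X Y) : Prop :=
  Nonempty ι ∧ ∀ s : Set ι, s.Nonempty → sᶜ.Nonempty → ∃ i ∈ s, ∃ j ∈ sᶜ, P.pairing i j ≠ 0

/-- Semisimple and simply-connected: the coroots span the cocharacter lattice over `ℤ`. -/
def IsSimplyConnected (P : RootDatum ι X Y) : Prop :=
  Submodule.span ℤ (Set.range P.coroot) = ⊤

/-- Semisimple and adjoint: the roots span the character lattice over `ℤ`. -/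
def IsAdjoint (P : RootDatum ι X Y) : Prop :=
  Submodule.span ℤ (Set.range P.root) = ⊤

/-- `χ` is quasi-constant: if `⟨χ, α^∨⟩ ≠ 0` then `⟨χ, w α^∨⟩ / ⟨χ, α^∨⟩ ∈ {-1, 0, 1}` for all `w`
in the Weyl group. -/
def IsQuasiConstant (P : RootDatum ι X Y) (χ : X) : Prop :=
  ∀ i : ι, P.toLinearMap χ (P.coroot i) ≠ 0 → ∀ w : P.weylGroup,
    (P.toLinearMap χ (P.coroot (P.weylGroupToPerm w i)) : ℚ) / (P.toLinearMap χ (P.coroot i) : ℚ)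
      ∈ ({-1, 0, 1} : Set ℚ)

/-- `χ` is minuscule: `⟨χ, α^∨⟩ ∈ {0, 1, -1}` for every root `α`. -/
def IsMinuscule (P : RootDatum ι X Y) (χ : X) : Prop :=
  ∀ i : ι, P.toLinearMap χ (P.coroot i) ∈ ({0, 1, -1} : Set ℤ)

/-- The pairing `⟨ξ, α^∨⟩` for `ξ ∈ X_ℚ`. -/
noncomputable def ratPairing (P : RootDatum ι X Y) (i : ι) : ℚ ⊗[ℤ] X →ₗ[ℚ] ℚ :=
  LinearMap.liftBaseChange ℚ ((Algebra.linearMap ℤ ℚ).comp (P.coroot' i))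

/-- `ξ ∈ X_ℚ` is minuscule. -/
def IsRatMinuscule (P : RootDatum ι X Y) (ξ : ℚ ⊗[ℤ] X) : Prop :=
  ∀ i : ι, P.ratPairing i ξ ∈ ({0, 1, -1} : Set ℚ)

/-- `ξ ∈ X_ℚ` is the fundamental weight attached to the simple root with index `i`. -/
def IsFundamentalWeight (P : RootDatum ι X Y) (b : P.Base) (i : ι) (ξ : ℚ ⊗[ℤ] X) : Prop :=
  P.ratPairing i ξ = 1 ∧ ∀ j ∈ b.support, j ≠ i → P.ratPairing j ξ = 0

/-- `χ` is cominuscule: for some base and some simple root `α`, `χ` is the fundamental weight of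
`α`, and the fundamental coweight of `α^∨` is minuscule. -/
def IsCominuscule (P : RootDatum ι X Y) (χ : X) : Prop :=
  ∃ b : P.Base, ∃ i ∈ b.support, IsFundamentalWeight P b i (1 ⊗ₜ[ℤ] χ) ∧
    ∃ η : ℚ ⊗[ℤ] Y, IsFundamentalWeight P.flip b.flip i η ∧ IsRatMinuscule P.flip η

end RootDatum

/-!
Write `a_α = ⟨χ, α^∨⟩`. If `a_α, a_β ≠ 0` and `α, β` are not orthogonal, quasi-constancy applied to
the reflections `s_α` and `s_β` forces `⟨α, β^∨⟩ a_α ∈ {a_β, 2 a_β}` and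
`⟨β, α^∨⟩ a_β ∈ {a_α, 2 a_α}`. Hence `|a_α| = |a_β|` or `|α|² |a_α| = |β|² |a_β|`, and moving `β` by
the Weyl group removes the orthogonality restriction. Since this dichotomy holds for all pairs, one
of the two alternatives holds throughout. The first one says that `χ` is a multiple of a minuscule
weight. In the second one `|α|² a_α` is additive in the root `α` and constant up to sign where it
does not vanish. On a base for which it is nonnegative it is therefore nonzero at only one simple
root, because some root involves any two given simple roots; so `χ` is a multiple of a fundamental
weight, and that weight is cominuscule.
-/

namespace QuasiConstant

open RootDatum

variable {ι X Y : Type*} [AddCommGroup X] [AddCommGroup Y]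

section Pairing

variable (P : RootDatum ι X Y)

lemma toLinearMap_coroot_reflectionPerm (χ : X) (i j : ι) :
    P.toLinearMap χ (P.coroot (P.reflectionPerm i j)) =
      P.toLinearMap χ (P.coroot j) - P.pairing i j * P.toLinearMap χ (P.coroot i) := by
  rw [← P.reflectionPerm_coroot i j, map_sub, map_smul]
  rfl

variable {P}

lemma isSimple_flip (hP : IsSimple P) : IsSimple P.flip := by
  refine ⟨hP.1, fun s hs hs' ↦ ?_⟩
  obtain ⟨i, hi, j, hj, h⟩ := hP.2 s hs hs'
  exact ⟨i, hi, j, hj, fun h0 ↦ h (P.pairing_eq_zero_iff'.mp h0)⟩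

lemma exists_mem_pairing_ne_zero (hP : IsSimple P) {A : Set ι} (hA : A.Nonempty)
    (hrefl : ∀ l ∉ A, ∀ t ∈ A, P.reflectionPerm l t ∈ A) (j : ι) :
    ∃ t ∈ A, P.pairing j t ≠ 0 := by
  by_contra! hj
  obtain ⟨t₀, ht₀⟩ := hA
  obtain ⟨k, hk, l, hl, hkl⟩ := hP.2 {k | ∀ t ∈ A, P.pairing k t = 0} ⟨j, hj⟩
    ⟨t₀, fun h ↦ by simpa using h t₀ ht₀⟩
  have hlA : l ∉ A := fun h ↦ hkl (hk l h)
  obtain ⟨t, ht, hlt⟩ : ∃ t ∈ A, P.pairing l t ≠ 0 := by simpa using hl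
  have hsum : P.pairing k (P.reflectionPerm l t) =
      P.pairing k t - P.pairing l t * P.pairing k l :=
    toLinearMap_coroot_reflectionPerm P (P.root k) l t
  rw [hk t ht, hk _ (hrefl l hlA t ht), zero_sub, eq_comm, neg_eq_zero] at hsum
  exact mul_ne_zero hlt hkl hsum

lemma exists_weylGroup_pairing_ne_zero (hP : IsSimple P) (i j : ι) :
    ∃ w : P.weylGroup, P.pairing i (P.weylGroupToPerm w j) ≠ 0 := by
  obtain ⟨-, ⟨w, rfl⟩, hw⟩ := exists_mem_pairing_ne_zero hP
    (A := Set.range fun w : P.weylGroup ↦ P.weylGroupToPerm w j) ⟨_, 1, rfl⟩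
    (by
      rintro l - - ⟨w, rfl⟩
      exact ⟨RootPairing.weylGroup.ofIdx P l * w,
        DFunLike.congr_fun (map_mul P.weylGroupToPerm _ w) j⟩) i
  exact ⟨w, hw⟩

end Pairing

section SquaredLength

variable [Fintype ι] (P : RootDatum ι X Y)

/-- The squared length of a root, for the canonical Weyl-invariant form `∑ α, α^∨ ⊗ α^∨`. -/
def sqLength (i : ι) : ℤ := P.RootForm (P.root i) (P.root i)

lemma sqLength_pos (i : ι) : 0 < sqLength P i :=
  P.rootForm_pos_of_ne_zero (Submodule.subset_span ⟨i, rfl⟩) (P.ne_zero i)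

lemma sqLength_weylGroupToPerm (w : P.weylGroup) (i : ι) :
    sqLength P (P.weylGroupToPerm w i) = sqLength P i := by
  have h := RootPairing.InvariantForm.apply_weylGroup_smul (P := P)
    (B := (P.posRootForm ℤ).toInvariantForm) w (P.root i) (P.root i)
  rwa [P.weylGroup_apply_root] at h

lemma pairing_mul_sqLength_comm (i j : ι) :
    P.pairing j i * sqLength P i = P.pairing i j * sqLength P j :=
  (P.posRootForm ℤ).toInvariantForm.pairing_mul_eq_pairing_mul_swap i j

lemma toLinearMap_root_two_smul_polarization (χ : X) (i : ι) :
    P.toLinearMap (P.root i) (2 • P.Polarization χ) =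
      sqLength P i * P.toLinearMap χ (P.coroot i) := by
  have h := congrArg (P.toLinearMap χ) (P.rootForm_self_smul_coroot i)
  simp only [map_smul, map_nsmul, smul_eq_mul, P.toLinearMap_apply_apply_Polarization] at h
  rw [map_nsmul, P.toLinearMap_apply_apply_Polarization, ← P.rootForm_symmetric.eq,
    RingHom.id_apply, sqLength, h]

lemma sqLength_smul_coroot_eq_add {i j k : ι} (h : P.root i = P.root j + P.root k) :
    sqLength P i • P.coroot i = sqLength P j • P.coroot j + sqLength P k • P.coroot k := by
  simp only [sqLength, P.rootForm_self_smul_coroot]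
  rw [h, map_add, nsmul_add]

end SquaredLength

section QuasiConstancy

variable (P : RootDatum ι X Y)

/-- The nonzero values among the weighted pairings `u i * ⟨χ, α_i^∨⟩` agree up to sign. Constant
weights `u` single out the multiples of minuscule weights, and squared lengths the multiples of
cominuscule ones. -/
def IsConstUpToSign (u : ι → ℤ) (χ : X) : Prop :=
  ∀ i j, P.toLinearMap χ (P.coroot i) ≠ 0 → P.toLinearMap χ (P.coroot j) ≠ 0 →
    |u i * P.toLinearMap χ (P.coroot i)| = |u j * P.toLinearMap χ (P.coroot j)|

variable {P} {χ : X}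

lemma isConstUpToSign_zsmul {u : ι → ℤ} (h : IsConstUpToSign P u χ) (m : ℤ) :
    IsConstUpToSign P u (m • χ) := by
  intro i j hi hj
  simp only [map_smul, LinearMap.smul_apply, smul_eq_mul, mul_ne_zero_iff, abs_mul,
    mul_left_comm _ |m|] at hi hj ⊢
  simpa only [abs_mul] using congrArg (|m| * ·) (h i j hi.2 hj.2)

lemma isConstUpToSign_of_zsmul {u : ι → ℤ} {m : ℤ} (hm : m ≠ 0)
    (h : IsConstUpToSign P u (m • χ)) : IsConstUpToSign P u χ := by
  have hval (i : ι) : P.toLinearMap (m • χ) (P.coroot i) = m * P.toLinearMap χ (P.coroot i) := by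
    simp
  intro i j hi hj
  have hij := h i j (hval i ▸ mul_ne_zero hm hi) (hval j ▸ mul_ne_zero hm hj)
  rw [hval, hval, mul_left_comm, mul_left_comm _ m, abs_mul m, abs_mul m] at hij
  exact mul_left_cancel₀ (abs_ne_zero.mpr hm) hij

lemma isConstUpToSign_of_forall_mem {u : ι → ℤ} (hu : ∀ i, u i ≠ 0) {c : ℤ}
    (h : ∀ i, u i * P.toLinearMap χ (P.coroot i) ∈ ({0, c, -c} : Set ℤ)) :
    IsConstUpToSign P u χ := by
  have key (i : ι) (hi : P.toLinearMap χ (P.coroot i) ≠ 0) :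
      |u i * P.toLinearMap χ (P.coroot i)| = |c| :=
    abs_eq_abs.mpr ((h i).resolve_left (mul_ne_zero (hu i) hi))
  intro i j hi hj
  rw [key i hi, key j hj]

lemma ratCast_div_mem_iff {a b : ℤ} (hb : b ≠ 0) :
    (a : ℚ) / b ∈ ({-1, 0, 1} : Set ℚ) ↔ a = 0 ∨ |a| = |b| := by
  have hb' : (b : ℚ) ≠ 0 := by exact_mod_cast hb
  simp only [Set.mem_insert_iff, Set.mem_singleton_iff, div_eq_iff hb', abs_eq_abs]
  norm_cast
  grind

lemma isQuasiConstant_iff_abs :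
    IsQuasiConstant P χ ↔ ∀ i, P.toLinearMap χ (P.coroot i) ≠ 0 → ∀ w : P.weylGroup,
      P.toLinearMap χ (P.coroot (P.weylGroupToPerm w i)) = 0 ∨
      |P.toLinearMap χ (P.coroot (P.weylGroupToPerm w i))| = |P.toLinearMap χ (P.coroot i)| :=
  forall₂_congr fun _ hi ↦ forall_congr' fun _ ↦ ratCast_div_mem_iff hi

lemma isQuasiConstant_of_isConstUpToSign {u : ι → ℤ} (hu : ∀ i, u i ≠ 0)
    (hinv : ∀ (w : P.weylGroup) (i : ι), u (P.weylGroupToPerm w i) = u i)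
    (h : IsConstUpToSign P u χ) : IsQuasiConstant P χ := by
  refine isQuasiConstant_iff_abs.mpr fun i hi w ↦ or_iff_not_imp_left.mpr fun hw ↦ ?_
  have hwi := h _ _ hw hi
  rw [hinv, abs_mul, abs_mul] at hwi
  exact mul_left_cancel₀ (abs_ne_zero.mpr (hu i)) hwi

lemma pairing_mul_eq_or_eq_two_mul (hχ : IsQuasiConstant P χ) {i j : ι}
    (hi : P.toLinearMap χ (P.coroot i) ≠ 0) (hj : P.toLinearMap χ (P.coroot j) ≠ 0)
    (hij : P.pairing i j ≠ 0) :
    P.pairing i j * P.toLinearMap χ (P.coroot i) = P.toLinearMap χ (P.coroot j) ∨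
    P.pairing i j * P.toLinearMap χ (P.coroot i) = 2 * P.toLinearMap χ (P.coroot j) := by
  have hrefl := isQuasiConstant_iff_abs.mp hχ j hj (RootPairing.weylGroup.ofIdx P i)
  change P.toLinearMap χ (P.coroot (P.reflectionPerm i j)) = 0 ∨
    |P.toLinearMap χ (P.coroot (P.reflectionPerm i j))| = _ at hrefl
  rw [toLinearMap_coroot_reflectionPerm, abs_eq_abs] at hrefl
  have := mul_ne_zero hij hi
  grind

lemma abs_eq_of_coxeterWeight_eq_four [Finite ι] [P.IsReduced] {i j : ι}
    (h : P.coxeterWeight i j = 4) :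
    |P.toLinearMap χ (P.coroot i)| = |P.toLinearMap χ (P.coroot j)| := by
  have := Module.IsReflexive.of_isPerfPair P.toLinearMap
  have := Module.IsReflexive.of_isPerfPair P.flip.toLinearMap
  rcases RootPairing.IsReduced.eq_or_eq_neg i j
    (P.coxeterWeight_eq_four_iff_not_linearIndependent.mp h) with h | h
  · rw [P.root.injective h]
  · rw [P.root_eq_neg_iff.mp h]
    simp

lemma mul_eq_one_or_two_or_four {a b p q : ℤ} (ha : a ≠ 0) (hb : b ≠ 0)
    (hp : p * a = b ∨ p * a = 2 * b) (hq : q * b = a ∨ q * b = 2 * a) :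
    p * q = 1 ∨ p * q = 2 ∨ p * q = 4 := by
  have cancel {c : ℤ} : p * q * (a * b) = c * (a * b) → p * q = c :=
    mul_right_cancel₀ (mul_ne_zero ha hb)
  rcases hp with hp | hp <;> rcases hq with hq | hq
  · exact .inl (cancel (by linear_combination q * b * hp + b * hq))
  · exact .inr (.inl (cancel (by linear_combination q * b * hp + b * hq)))
  · exact .inr (.inl (cancel (by linear_combination q * b * hp + 2 * b * hq)))
  · exact .inr (.inr (cancel (by linear_combination q * b * hp + 2 * b * hq)))

lemma abs_eq_or_mul_abs_eq_of_isUnit {a b p q L M : ℤ} (hu : IsUnit p) (hb : b ≠ 0)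
    (hp : p * a = b ∨ p * a = 2 * b) (hq : q * b = a ∨ q * b = 2 * a) (hpq : p * q ≠ 4)
    (hLM : q * L = p * M) : |a| = |b| ∨ |L * a| = |M * b| := by
  have hp1 : |p| = 1 := Int.isUnit_iff_abs_eq.mp hu
  rcases hp with hp | hp
  · exact .inl (by rw [← hp, abs_mul, hp1, one_mul])
  rcases hq with hq | hq
  · have h : L * a = p * (M * b) := by linear_combination b * hLM - L * hq
    exact .inr (by rw [h, abs_mul, hp1, one_mul])
  · refine absurd (mul_right_cancel₀ hb ?_) hpq
    linear_combination 2 * hp + p * hq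

lemma abs_eq_or_sqLength_mul_abs_eq_of_pairing_ne_zero [Fintype ι] [P.IsReduced]
    (hχ : IsQuasiConstant P χ) {i j : ι} (hi : P.toLinearMap χ (P.coroot i) ≠ 0)
    (hj : P.toLinearMap χ (P.coroot j) ≠ 0) (hij : P.pairing i j ≠ 0) :
    |P.toLinearMap χ (P.coroot i)| = |P.toLinearMap χ (P.coroot j)| ∨
    |sqLength P i * P.toLinearMap χ (P.coroot i)| =
      |sqLength P j * P.toLinearMap χ (P.coroot j)| := by
  have hji : P.pairing j i ≠ 0 := P.pairing_eq_zero_iff'.not.mp hij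
  have h₁ := pairing_mul_eq_or_eq_two_mul hχ hi hj hij
  have h₂ := pairing_mul_eq_or_eq_two_mul hχ hj hi hji
  have hL := pairing_mul_sqLength_comm P i j
  by_cases h₄ : P.coxeterWeight i j = 4
  · exact .inl (abs_eq_of_coxeterWeight_eq_four h₄)
  have hunit : IsUnit (P.pairing i j) ∨ IsUnit (P.pairing j i) := by
    rcases mul_eq_one_or_two_or_four hi hj h₁ h₂ with h | h | h
    · exact .inl (.of_mul_eq_one _ h)
    · exact Int.prime_two.irreducible.isUnit_or_isUnit h.symm
    · exact absurd h h₄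
  rcases hunit with hu | hu
  · exact abs_eq_or_mul_abs_eq_of_isUnit hu hj h₁ h₂ h₄ hL
  · exact (abs_eq_or_mul_abs_eq_of_isUnit hu hi h₂ h₁ (by rwa [mul_comm]) hL.symm).imp
      Eq.symm Eq.symm

lemma abs_eq_or_sqLength_mul_abs_eq [Fintype ι] [P.IsReduced] (hP : IsSimple P)
    (hχ : IsQuasiConstant P χ) {i j : ι} (hi : P.toLinearMap χ (P.coroot i) ≠ 0)
    (hj : P.toLinearMap χ (P.coroot j) ≠ 0) :
    |P.toLinearMap χ (P.coroot i)| = |P.toLinearMap χ (P.coroot j)| ∨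
    |sqLength P i * P.toLinearMap χ (P.coroot i)| =
      |sqLength P j * P.toLinearMap χ (P.coroot j)| := by
  obtain ⟨w, hw, hne⟩ : ∃ w : P.weylGroup, P.pairing i (P.weylGroupToPerm w j) ≠ 0 ∧
      P.toLinearMap χ (P.coroot (P.weylGroupToPerm w j)) ≠ 0 := by
    obtain ⟨w, hw⟩ := exists_weylGroup_pairing_ne_zero hP i j
    by_cases h : P.toLinearMap χ (P.coroot (P.weylGroupToPerm w j)) = 0
    · refine ⟨RootPairing.weylGroup.ofIdx P i * w, ?_⟩
      have hperm : P.weylGroupToPerm (RootPairing.weylGroup.ofIdx P i * w) j =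
          P.reflectionPerm i (P.weylGroupToPerm w j) :=
        DFunLike.congr_fun (map_mul P.weylGroupToPerm _ w) j
      rw [hperm, P.pairing_reflectionPerm, P.pairing_reflectionPerm_self_left,
        toLinearMap_coroot_reflectionPerm, h, zero_sub, neg_ne_zero, neg_ne_zero]
      exact ⟨hw, mul_ne_zero hw hi⟩
    · exact ⟨w, hw, h⟩
  have hwj := (isQuasiConstant_iff_abs.mp hχ j hj w).resolve_left hne
  have key := abs_eq_or_sqLength_mul_abs_eq_of_pairing_ne_zero hχ hi hne hw
  rwa [abs_mul _ (P.toLinearMap χ (P.coroot (P.weylGroupToPerm w j))),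
    sqLength_weylGroupToPerm, hwj, ← abs_mul] at key

lemma forall_eq_or_forall_eq_of_forall_eq_or_eq {α β γ : Type*} {f : α → β} {g : α → γ}
    (h : ∀ x y, f x = f y ∨ g x = g y) : (∀ x y, f x = f y) ∨ ∀ x y, g x = g y := by
  by_contra! ⟨⟨x, y, hf⟩, z, t, hg⟩
  have := h z t
  have := h x z
  have := h x t
  have := h y z
  grind

lemma isQuasiConstant_iff_isConstUpToSign [Fintype ι] [P.IsReduced] (hP : IsSimple P) :
    IsQuasiConstant P χ ↔ IsConstUpToSign P 1 χ ∨ IsConstUpToSign P (sqLength P) χ := by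
  constructor
  · intro hχ
    have h := forall_eq_or_forall_eq_of_forall_eq_or_eq
      fun x y : {i // P.toLinearMap χ (P.coroot i) ≠ 0} ↦
        abs_eq_or_sqLength_mul_abs_eq hP hχ x.2 y.2
    refine h.imp (fun h i j hi hj ↦ ?_) (fun h i j hi hj ↦ h ⟨i, hi⟩ ⟨j, hj⟩)
    simpa using h ⟨i, hi⟩ ⟨j, hj⟩
  · rintro (h | h)
    · exact isQuasiConstant_of_isConstUpToSign (fun _ ↦ one_ne_zero) (fun _ _ ↦ rfl) h
    · exact isQuasiConstant_of_isConstUpToSign (fun i ↦ (sqLength_pos P i).ne')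
        (sqLength_weylGroupToPerm P) h

end QuasiConstancy

section Multiples

lemma dvd_apply_of_mem_span {M : Type*} [AddCommGroup M] {s : Set M} {φ : M →ₗ[ℤ] ℤ} {m : ℤ}
    (h : ∀ x ∈ s, m ∣ φ x) {x : M} (hx : x ∈ Submodule.span ℤ s) : m ∣ φ x := by
  have hle : Submodule.span ℤ s ≤ Submodule.comap φ (Ideal.span {m}) :=
    Submodule.span_le.mpr fun y hy ↦ Ideal.mem_span_singleton.mpr (h y hy)
  exact Ideal.mem_span_singleton.mp (hle hx)

lemma exists_eq_smul_of_forall_dvd {M : Type*} [AddCommGroup M] {φ : M →ₗ[ℤ] ℤ} {m : ℤ}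
    (h : ∀ x, m ∣ φ x) : ∃ ψ : M →ₗ[ℤ] ℤ, φ = m • ψ := by
  refine ⟨AddMonoidHom.toIntLinearMap
    { toFun := fun x ↦ φ x / m
      map_zero' := by simp
      map_add' := fun x y ↦ by rw [map_add, Int.add_ediv_of_dvd_left (h x)] }, ?_⟩
  ext x
  exact (Int.mul_ediv_cancel' (h x)).symm

variable {P : RootDatum ι X Y}

lemma eq_zero_of_isSimplyConnected (hP : IsSimplyConnected P) {χ : X}
    (h : ∀ i, P.toLinearMap χ (P.coroot i) = 0) : χ = 0 := by
  refine P.toPerfPair.injective (LinearMap.ext_on_range hP fun i ↦ ?_)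
  simpa using h i

lemma exists_eq_smul_of_isSimplyConnected (hP : IsSimplyConnected P) {χ : X} {m : ℤ}
    (h : ∀ i, m ∣ P.toLinearMap χ (P.coroot i)) : ∃ ξ : X, χ = m • ξ := by
  obtain ⟨ψ, hψ⟩ := exists_eq_smul_of_forall_dvd fun y ↦
    dvd_apply_of_mem_span (φ := P.toLinearMap χ) (m := m) (Set.forall_mem_range.mpr h)
      (hP ▸ Submodule.mem_top)
  refine ⟨P.toPerfPair.symm ψ, P.toPerfPair.injective ?_⟩
  rw [map_smul, LinearEquiv.apply_symm_apply]
  exact hψ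

lemma isConstUpToSign_one_of_isMinuscule {ξ : X} (hξ : IsMinuscule P ξ) :
    IsConstUpToSign P 1 ξ :=
  isConstUpToSign_of_forall_mem (fun _ ↦ one_ne_zero)
    fun i ↦ by simpa only [Pi.one_apply, one_mul] using hξ i

lemma exists_isMinuscule_of_isConstUpToSign_one (hP : IsSimplyConnected P) {χ : X}
    (hχ : IsConstUpToSign P 1 χ) : ∃ (m : ℤ) (ξ : X), IsMinuscule P ξ ∧ χ = m • ξ := by
  by_cases h0 : ∀ i, P.toLinearMap χ (P.coroot i) = 0
  · exact ⟨0, 0, fun i ↦ by simp, by rw [eq_zero_of_isSimplyConnected hP h0, smul_zero]⟩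
  push Not at h0
  obtain ⟨i, hi⟩ := h0
  have habs (j : ι) (hj : P.toLinearMap χ (P.coroot j) ≠ 0) :
      |P.toLinearMap χ (P.coroot j)| = |P.toLinearMap χ (P.coroot i)| := by
    simpa using hχ j i hj hi
  obtain ⟨ξ, hξ⟩ := exists_eq_smul_of_isSimplyConnected hP
    (m := P.toLinearMap χ (P.coroot i)) fun j ↦ by
      by_cases hj : P.toLinearMap χ (P.coroot j) = 0
      · exact hj ▸ dvd_zero _
      · rw [← abs_dvd_abs, habs j hj]
  refine ⟨_, ξ, fun j ↦ ?_, hξ⟩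
  have hval : P.toLinearMap χ (P.coroot j) =
      P.toLinearMap χ (P.coroot i) * P.toLinearMap ξ (P.coroot j) := by
    conv_lhs => rw [hξ]
    simp
  by_cases hj : P.toLinearMap χ (P.coroot j) = 0
  · exact .inl ((mul_eq_zero.mp (hval.symm.trans hj)).resolve_left hi)
  · refine .inr (eq_or_eq_neg_of_abs_eq (mul_left_cancel₀ (abs_ne_zero.mpr hi) ?_))
    rw [← abs_mul, ← hval, habs j hj, mul_one]

end Multiples

section Cominuscule

variable {P : RootDatum ι X Y}

lemma ratPairing_tmul (P : RootDatum ι X Y) (i : ι) (q : ℚ) (χ : X) :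
    P.ratPairing i (q ⊗ₜ[ℤ] χ) = q * P.toLinearMap χ (P.coroot i) := by
  simp [ratPairing]

lemma exists_linearMap_apply_coroot_eq_ratPairing (P : RootDatum ι X Y) (ξ : ℚ ⊗[ℤ] X) :
    ∃ g : Y →ₗ[ℤ] ℚ, ∀ i, g (P.coroot i) = P.ratPairing i ξ := by
  induction ξ using TensorProduct.induction_on with
  | zero => exact ⟨0, by simp⟩
  | tmul q χ =>
    exact ⟨q • (Algebra.linearMap ℤ ℚ).comp (P.toLinearMap χ), fun i ↦ by simp [ratPairing_tmul]⟩
  | add x y hx hy =>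
    obtain ⟨f, hf⟩ := hx
    obtain ⟨g, hg⟩ := hy
    exact ⟨f + g, fun i ↦ by simp [hf, hg]⟩

lemma apply_root_eq_of_eqOn_support {M : Type*} [AddCommGroup M] (b : P.Base) {f g : X →ₗ[ℤ] M}
    (h : ∀ i ∈ b.support, f (P.root i) = g (P.root i)) (i : ι) :
    f (P.root i) = g (P.root i) :=
  LinearMap.eqOn_span (s := P.root '' b.support) (by rintro - ⟨j, hj, rfl⟩; exact h j hj)
    (b.root_mem_span_int i)

lemma isConstUpToSign_sqLength_of_isCominuscule [Fintype ι] {ξ : X} (h : IsCominuscule P ξ) :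
    IsConstUpToSign P (sqLength P) ξ := by
  obtain ⟨b, i, -, ⟨hξi, hξ⟩, η, ⟨hηi, hη⟩, hmin⟩ := h
  simp only [ratPairing_tmul, one_mul, Int.cast_eq_zero, Int.cast_eq_one] at hξi hξ
  obtain ⟨g, hg⟩ := exists_linearMap_apply_coroot_eq_ratPairing P.flip η
  replace hg (j : ι) : g (P.root j) = ratPairing P.flip j η := hg j
  let f : X →ₗ[ℤ] ℚ := (Algebra.linearMap ℤ ℚ).comp (P.toLinearMap.flip (2 • P.Polarization ξ))
  have hf (j : ι) : f (P.root j) = (sqLength P j * P.toLinearMap ξ (P.coroot j) : ℤ) :=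
    congrArg (Int.cast : ℤ → ℚ) (toLinearMap_root_two_smul_polarization P ξ j)
  have hfg := apply_root_eq_of_eqOn_support b (f := f) (g := (sqLength P i : ℚ) • g)
    fun j hj ↦ by
      rw [hf, LinearMap.smul_apply, hg, smul_eq_mul]
      by_cases hji : j = i
      · rw [hji, hξi, hηi]
        simp
      · rw [hξ j hj hji, hη j hj hji]
        simp
  refine isConstUpToSign_of_forall_mem (c := sqLength P i) (fun j ↦ (sqLength_pos P j).ne')
    fun j ↦ ?_
  have hval := hfg j
  rw [hf, LinearMap.smul_apply, hg, smul_eq_mul] at hval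
  rcases hmin j with h | h | h <;> rw [h] at hval
  · exact .inl (by simpa using hval)
  · exact .inr (.inl (by rw [mul_one] at hval; exact_mod_cast hval))
  · exact .inr (.inr (Set.mem_singleton_iff.mpr (by rw [mul_neg_one] at hval; exact_mod_cast hval)))

lemma isCominuscule_of_isConstUpToSign_sqLength [Fintype ι] {ξ : X}
    (h : IsConstUpToSign P (sqLength P) ξ) (b : P.Base) {i : ι} (hi : i ∈ b.support)
    (hξi : P.toLinearMap ξ (P.coroot i) = 1)
    (hξ : ∀ j ∈ b.support, j ≠ i → P.toLinearMap ξ (P.coroot j) = 0) : IsCominuscule P ξ := by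
  have hLi := (sqLength_pos P i).ne'
  have hη (j : ι) : ratPairing P.flip j ((sqLength P i : ℚ)⁻¹ ⊗ₜ[ℤ] (2 • P.Polarization ξ)) =
      (sqLength P j * P.toLinearMap ξ (P.coroot j) : ℤ) / sqLength P i := by
    rw [ratPairing_tmul, inv_mul_eq_div, ← toLinearMap_root_two_smul_polarization]
    rfl
  refine ⟨b, i, hi, ⟨?_, fun j hj hji ↦ ?_⟩, _, ⟨(hη i).trans ?_, fun j hj hji ↦ (hη j).trans ?_⟩,
    fun j ↦ (hη j).symm ▸ ?_⟩
  · rw [ratPairing_tmul, hξi, one_mul, Int.cast_one]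
  · rw [ratPairing_tmul, hξ j hj hji, Int.cast_zero, mul_zero]
  · rw [hξi, mul_one, div_self (Int.cast_ne_zero.mpr hLi)]
  · rw [hξ j hj hji, mul_zero, Int.cast_zero, zero_div]
  · have hj : sqLength P j * P.toLinearMap ξ (P.coroot j) = 0 ∨
        |sqLength P j * P.toLinearMap ξ (P.coroot j)| = |sqLength P i| := by
      refine or_iff_not_imp_left.mpr fun hj0 ↦ ?_
      simpa [hξi] using h j i (right_ne_zero_of_mul hj0) (hξi ▸ one_ne_zero)
    have := (ratCast_div_mem_iff hLi).mpr hj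
    rwa [Set.insert_comm, Set.pair_comm (-1)] at this

end Cominuscule

section Base

lemma exists_perturbation_apply_ne_zero {κ M : Type*} [Finite κ] [AddCommGroup M] (v : κ → M)
    (f g : M →ₗ[ℤ] ℤ) : ∃ h : M →ₗ[ℤ] ℤ, (∀ i, f (v i) ≠ 0 ∨ g (v i) ≠ 0 → h (v i) ≠ 0) ∧
      ∀ i, 0 < f (v i) → 0 < h (v i) := by
  have := Fintype.ofFinite κ
  let N : ℤ := ∑ i, |g (v i)| + 1
  have hN (i : κ) : |g (v i)| < N := Int.lt_add_one_of_le <|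
    Finset.single_le_sum (f := fun i ↦ |g (v i)|) (fun _ _ ↦ abs_nonneg _) (Finset.mem_univ i)
  have hdom (i : κ) (hi : f (v i) ≠ 0) : |g (v i)| < N * |f (v i)| :=
    (hN i).trans_le <| le_mul_of_one_le_right ((abs_nonneg _).trans_lt (hN i)).le
      (Int.one_le_abs hi)
  have hval (i : κ) : (N • f + g) (v i) = N * f (v i) + g (v i) := by simp
  refine ⟨N • f + g, fun i hi ↦ ?_, fun i hi ↦ ?_⟩
  · rw [hval]
    by_cases hf : f (v i) = 0
    · simpa [hf] using hi
    · intro h0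
      have := hdom i hf
      rw [eq_neg_of_add_eq_zero_right h0, abs_neg, abs_mul] at this
      exact this.not_ge (mul_le_mul_of_nonneg_right (le_abs_self N) (abs_nonneg _))
  · rw [hval]
    have := hdom i hi.ne'
    rw [abs_of_pos hi] at this
    linarith [neg_abs_le (g (v i))]

lemma exists_forall_apply_ne_zero_of_pos {κ M : Type*} [Finite κ] [AddCommGroup M] {v : κ → M}
    (hv : ∀ i, ∃ g : M →ₗ[ℤ] ℤ, g (v i) ≠ 0) (φ : M →ₗ[ℤ] ℤ) :
    ∃ f : M →ₗ[ℤ] ℤ, (∀ i, f (v i) ≠ 0) ∧ ∀ i, 0 < φ (v i) → 0 < f (v i) := by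
  classical
  have := Fintype.ofFinite κ
  suffices ∀ s : Finset κ, ∃ f : M →ₗ[ℤ] ℤ, (∀ i ∈ s, f (v i) ≠ 0) ∧
      ∀ i, 0 < φ (v i) → 0 < f (v i) by simpa using this Finset.univ
  intro s
  induction s using Finset.induction_on with
  | empty => exact ⟨φ, by simp, fun _ ↦ id⟩
  | insert a s _ ih =>
    obtain ⟨f, hf, hφ⟩ := ih
    obtain ⟨g, hg⟩ := hv a
    obtain ⟨h, hne, hpos⟩ := exists_perturbation_apply_ne_zero v f g
    exact ⟨h, Finset.forall_mem_insert _ _ _ |>.mpr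
      ⟨hne a (.inr hg), fun i hi ↦ hne i (.inl (hf i hi))⟩, fun i hi ↦ hpos i (hφ i hi)⟩

lemma exists_eq_nsmul_of_smul_eq_add {κ M : Type*} [AddCommGroup M] {v : κ → M} {s : Set κ}
    (hs : s.Finite) (hv : LinearIndepOn ℤ v s) {i : κ} (hi : i ∈ s) {x y : M}
    (hx : x ∈ AddSubmonoid.closure (v '' s)) (hy : y ∈ AddSubmonoid.closure (v '' s))
    {a b c : ℤ} (hb : 0 < b) (hc : 0 < c) (h : a • v i = b • x + c • y) :
    ∃ n : ℕ, x = n • v i := by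
  classical
  have := hs.fintype
  rw [← Submodule.span_nat_eq_addSubmonoidClosure, Submodule.mem_toAddSubmonoid,
    Fintype.mem_span_image_iff_exists_fun] at hx hy
  obtain ⟨f, rfl⟩ := hx
  obtain ⟨g, rfl⟩ := hy
  have hsum : ∑ k : s, (if k = ⟨i, hi⟩ then a else 0) • v k =
      ∑ k : s, (b * f k + c * g k) • v k := by
    simp only [ite_smul, zero_smul, Finset.sum_ite_eq', Finset.mem_univ, if_true, h,
      Finset.smul_sum, ← Finset.sum_add_distrib, add_smul, mul_smul, natCast_zsmul]
  have hcoeff := Fintype.linearIndependent_iffₛ.mp hv _ _ hsum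
  refine ⟨f ⟨i, hi⟩, Fintype.sum_eq_single (⟨i, hi⟩ : s) fun k hk ↦ ?_⟩
  have hk0 := hcoeff k
  rw [if_neg hk, eq_comm, add_eq_zero_iff_of_nonneg (by positivity) (by positivity)] at hk0
  rw [Int.natCast_eq_zero.mp ((mul_eq_zero.mp hk0.1).resolve_left hb.ne'), zero_smul]

open IsAddIndecomposable

variable [Finite ι] {P : RootDatum ι X Y} [P.IsReduced]

lemma baseOf_root_subset_baseOf_coroot {f : X →ₗ[ℤ] ℤ} {g : Y →ₗ[ℤ] ℤ}
    (hf : ∀ i, f (P.root i) ≠ 0) (hfg : ∀ i, 0 < f (P.root i) ↔ 0 < g (P.coroot i)) :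
    baseOf P.root (f : X →+ ℤ) ⊆ baseOf P.coroot (g : Y →+ ℤ) := by
  have := Fintype.ofFinite ι
  have := Module.IsReflexive.of_isPerfPair P.toLinearMap
  refine fun i hi ↦ ⟨(hfg i).mp hi.1, fun j hj k hk h ↦ ?_⟩
  exfalso
  have hmem (l : ι) (hl : 0 < g (P.coroot l)) :
      P.root l ∈ AddSubmonoid.closure (P.root '' baseOf P.root (f : X →+ ℤ)) := by
    rw [AddSubmonoid.closure_image_isAddIndecomposable_baseOf]
    exact AddSubmonoid.subset_closure ⟨l, (hfg l).mpr hl, rfl⟩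
  obtain ⟨n, hn⟩ := exists_eq_nsmul_of_smul_eq_add (Set.toFinite _)
    (P.linearIndepOn_root_baseOf' f hf) hi (hmem j hj) (hmem k hk)
    (sqLength_pos P.flip j) (sqLength_pos P.flip k) (sqLength_smul_coroot_eq_add P.flip h)
  have hij : ¬ LinearIndependent ℤ ![P.root i, P.root j] := by
    simp only [LinearIndependent.pair_iff, not_forall]
    exact ⟨n, -1, by simp [hn], by simp⟩
  rcases RootPairing.IsReduced.eq_or_eq_neg i j hij with hij | hij
  · obtain rfl := P.root.injective hij
    exact P.ne_zero' k (by simpa using h)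
  · have hpos : 0 < f (P.root i) := hi.1
    rw [hij, map_neg, neg_pos] at hpos
    exact hpos.not_gt ((hfg j).mpr hj)

lemma exists_base_forall_pos {f : X →ₗ[ℤ] ℤ} {g : Y →ₗ[ℤ] ℤ} (hf : ∀ i, f (P.root i) ≠ 0)
    (hg : ∀ i, g (P.coroot i) ≠ 0) (hfg : ∀ i, 0 < f (P.root i) ↔ 0 < g (P.coroot i)) :
    ∃ b : P.Base, ∀ i ∈ b.support, 0 < f (P.root i) := by
  have := Module.IsReflexive.of_isPerfPair P.toLinearMap
  have := Module.IsReflexive.of_isPerfPair P.flip.toLinearMap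
  have hbase : baseOf P.root (f : X →+ ℤ) = baseOf P.coroot (g : Y →+ ℤ) :=
    (baseOf_root_subset_baseOf_coroot hf hfg).antisymm
      (baseOf_root_subset_baseOf_coroot (P := P.flip) hg fun i ↦ (hfg i).symm)
  let := P.indexNeg
  let b : P.Base :=
    { support := (Set.toFinite (baseOf P.root (f : X →+ ℤ))).toFinset
      linearIndepOn_root := by simpa using P.linearIndepOn_root_baseOf' f hf
      linearIndepOn_coroot := by
        rw [Set.Finite.coe_toFinset, hbase]
        exact P.flip.linearIndepOn_root_baseOf' g hg
      root_mem_or_neg_mem := fun i ↦ by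
        rw [Set.Finite.coe_toFinset]
        exact mem_or_neg_mem_closure_baseOf P.root (f : X →+ ℤ) i (hf i) (by simp)
      coroot_mem_or_neg_mem := fun i ↦ by
        rw [Set.Finite.coe_toFinset, hbase]
        exact mem_or_neg_mem_closure_baseOf P.coroot (g : Y →+ ℤ) i (hg i) (by simp) }
  exact ⟨b, fun i hi ↦ ((Set.Finite.mem_toFinset _).mp hi).1⟩

lemma exists_base_forall_pos_of_forall_ne_zero {f : X →ₗ[ℤ] ℤ} (hf : ∀ i, f (P.root i) ≠ 0) :
    ∃ b : P.Base, ∀ i ∈ b.support, 0 < f (P.root i) := by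
  have := Fintype.ofFinite ι
  obtain ⟨y, rfl⟩ := P.flip.toPerfPair.surjective f
  let g : Y →ₗ[ℤ] ℤ := P.toLinearMap (2 • P.flip.Polarization y)
  have hg (i : ι) : g (P.coroot i) = sqLength P.flip i * P.flip.toPerfPair y (P.root i) :=
    toLinearMap_root_two_smul_polarization P.flip y i
  refine exists_base_forall_pos (g := g) hf (fun i ↦ ?_) fun i ↦ ?_
  · exact hg i ▸ mul_ne_zero (sqLength_pos P.flip i).ne' (hf i)
  · rw [hg, mul_pos_iff_of_pos_left (sqLength_pos P.flip i)]

variable (P) in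
lemma exists_base_forall_nonneg (φ : X →ₗ[ℤ] ℤ) :
    ∃ b : P.Base, ∀ i ∈ b.support, 0 ≤ φ (P.root i) := by
  obtain ⟨f, hf, hφ⟩ := exists_forall_apply_ne_zero_of_pos (v := P.root)
    (fun i ↦ ⟨P.coroot' i, by simp⟩) φ
  obtain ⟨b, hb⟩ := exists_base_forall_pos_of_forall_ne_zero hf
  refine ⟨b, fun i hi ↦ ?_⟩
  by_contra! h
  have hneg := hφ (P.reflectionPerm i i) (by simpa using h)
  simp only [P.root_reflectionPerm, P.reflection_apply_self, map_neg, neg_pos] at hneg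
  exact hneg.not_gt (hb i hi)

end Base

section FullSupport

variable {P : RootDatum ι X Y}

lemma exists_root_notMem_span_diff_singleton (hP : IsSimple P) (b : P.Base) {i j : ι}
    (hi : i ∈ b.support) (hj : j ∈ b.support) :
    ∃ t, P.root t ∉ Submodule.span ℤ (P.root '' (b.support \ {i})) ∧
      P.root t ∉ Submodule.span ℤ (P.root '' (b.support \ {j})) := by
  have hli := b.linearIndepOn_root
  rcases eq_or_ne i j with rfl | hij
  · exact ⟨i, hli.notMem_span hi, hli.notMem_span hi⟩
  have hrefl {l t : ι} {S : Submodule ℤ X} (hl : P.root l ∈ S) (ht : P.root t ∉ S) :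
      P.root (P.reflectionPerm l t) ∉ S := by
    rw [P.root_reflectionPerm, P.reflection_apply]
    exact fun h ↦ ht ((Submodule.sub_mem_iff_left _ (S.smul_mem _ hl)).mp h)
  obtain ⟨t, ht, hjt⟩ := exists_mem_pairing_ne_zero hP
    (A := {t | P.root t ∉ Submodule.span ℤ (P.root '' (b.support \ {i}))})
    ⟨i, hli.notMem_span hi⟩ (fun l hl t ht ↦ hrefl (not_not.mp hl) ht) j
  by_cases htj : P.root t ∈ Submodule.span ℤ (P.root '' (b.support \ {j}))
  · refine ⟨P.reflectionPerm j t,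
      hrefl (Submodule.subset_span ⟨j, ⟨hj, hij.symm⟩, rfl⟩) ht, fun h ↦ ?_⟩
    rw [P.root_reflectionPerm, P.reflection_apply, Submodule.sub_mem_iff_right _ htj] at h
    exact P.pairing_eq_zero_iff'.not.mp hjt (hli.eq_zero_of_smul_mem_span hj _ h)
  · exact ⟨t, ht, htj⟩

lemma exists_add_le_abs_apply_root (hP : IsSimple P) (b : P.Base) {i j : ι}
    (hi : i ∈ b.support) (hj : j ∈ b.support) (hij : i ≠ j) {φ : X →ₗ[ℤ] ℤ}
    (hφ : ∀ k ∈ b.support, 0 ≤ φ (P.root k)) :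
    ∃ t, φ (P.root i) + φ (P.root j) ≤ |φ (P.root t)| := by
  obtain ⟨t, hti, htj⟩ := exists_root_notMem_span_diff_singleton hP b hi hj
  obtain ⟨c, -, hc⟩ := b.exists_root_eq_sum_nat_or_neg t
  have hcpos {l : ι} (hl : P.root t ∉ Submodule.span ℤ (P.root '' (b.support \ {l}))) :
      1 ≤ c l := by
    rw [Nat.one_le_iff_ne_zero]
    intro h0
    have hmem : ∑ k ∈ b.support, c k • P.root k ∈
        Submodule.span ℤ (P.root '' (b.support \ {l})) := by
      refine Submodule.sum_mem _ fun k hk ↦ ?_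
      rcases eq_or_ne k l with rfl | hkl
      · simp [h0]
      · exact nsmul_mem (Submodule.subset_span (Set.mem_image_of_mem P.root (by simp [hk, hkl]))) _
    exact hl (hc.elim (fun h ↦ h ▸ hmem) fun h ↦ h ▸ neg_mem hmem)
  have habs : |φ (P.root t)| = |∑ k ∈ b.support, c k • φ (P.root k)| := by
    rcases hc with h | h <;> simp [h, map_sum]
  refine ⟨t, habs ▸ le_trans ?_ (le_abs_self _)⟩
  have hle {l : ι} (hl : l ∈ b.support) (hcl : 1 ≤ c l) : φ (P.root l) ≤ c l • φ (P.root l) := by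
    simpa using nsmul_le_nsmul_left (hφ l hl) hcl
  calc φ (P.root i) + φ (P.root j)
      ≤ c i • φ (P.root i) + c j • φ (P.root j) :=
        add_le_add (hle hi (hcpos hti)) (hle hj (hcpos htj))
    _ ≤ ∑ k ∈ b.support, c k • φ (P.root k) :=
        Finset.add_le_sum (fun k hk ↦ nsmul_nonneg (hφ k hk) _) hi hj hij

lemma exists_base_support_eq_single [Finite ι] [P.IsReduced] (hP : IsSimple P) {φ : X →ₗ[ℤ] ℤ}
    (hφ : ∀ i j, φ (P.root i) ≠ 0 → φ (P.root j) ≠ 0 → |φ (P.root i)| = |φ (P.root j)|)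
    (h0 : ∃ i, φ (P.root i) ≠ 0) :
    ∃ b : P.Base, ∃ i ∈ b.support, φ (P.root i) ≠ 0 ∧
      ∀ j ∈ b.support, j ≠ i → φ (P.root j) = 0 := by
  obtain ⟨b, hb⟩ := exists_base_forall_nonneg P φ
  obtain ⟨i, hi, hi0⟩ : ∃ i ∈ b.support, φ (P.root i) ≠ 0 := by
    by_contra! h
    obtain ⟨t, ht⟩ := h0
    exact ht (by simpa using apply_root_eq_of_eqOn_support b (f := φ) (g := 0) (by simpa using h) t)
  refine ⟨b, i, hi, hi0, fun j hj hji ↦ ?_⟩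
  by_contra hj0
  obtain ⟨t, ht⟩ := exists_add_le_abs_apply_root hP b hi hj hji.symm hb
  have hipos := (hb i hi).lt_of_ne' hi0
  have hjpos := (hb j hj).lt_of_ne' hj0
  have hti := hφ t i (fun h ↦ by rw [h, abs_zero] at ht; linarith) hi0
  rw [hti, abs_of_pos hipos] at ht
  linarith

end FullSupport

section Main

variable {P : RootDatum ι X Y} [P.IsReduced]

lemma exists_isCominuscule_of_isConstUpToSign_sqLength [Fintype ι] (hP : IsSimple P)
    (hsc : IsSimplyConnected P) {χ : X} (hχ : IsConstUpToSign P (sqLength P) χ)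
    (h0 : ∃ i, P.toLinearMap χ (P.coroot i) ≠ 0) :
    ∃ (m : ℤ) (ξ : X), IsCominuscule P ξ ∧ χ = m • ξ := by
  obtain ⟨b, i, hi, hχi, hsupp⟩ : ∃ b : P.Base, ∃ i ∈ b.support,
      P.toLinearMap χ (P.coroot i) ≠ 0 ∧
      ∀ j ∈ b.support, j ≠ i → P.toLinearMap χ (P.coroot j) = 0 := by
    let φ : X →ₗ[ℤ] ℤ := P.toLinearMap.flip (2 • P.Polarization χ)
    have hφ (j : ι) : φ (P.root j) = sqLength P j * P.toLinearMap χ (P.coroot j) :=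
      toLinearMap_root_two_smul_polarization P χ j
    have hφ0 (j : ι) : φ (P.root j) = 0 ↔ P.toLinearMap χ (P.coroot j) = 0 := by
      rw [hφ, mul_eq_zero_iff_left (sqLength_pos P j).ne']
    simp only [ne_eq, ← hφ0] at h0 ⊢
    refine exists_base_support_eq_single hP (φ := φ) (fun j k hj hk ↦ ?_) h0
    rw [hφ, hφ]
    exact hχ j k ((hφ0 j).not.mp hj) ((hφ0 k).not.mp hk)
  obtain ⟨ξ, hξ⟩ := exists_eq_smul_of_isSimplyConnected hsc (m := P.toLinearMap χ (P.coroot i))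
    fun j ↦ dvd_apply_of_mem_span (s := P.coroot '' b.support) (by
      rintro - ⟨k, hk, rfl⟩
      by_cases hki : k = i
      · rw [hki]
      · exact hsupp k hk hki ▸ dvd_zero _) (b.coroot_mem_span_int j)
  have hval (j : ι) : P.toLinearMap χ (P.coroot j) =
      P.toLinearMap χ (P.coroot i) * P.toLinearMap ξ (P.coroot j) := by
    conv_lhs => rw [hξ]
    simp
  refine ⟨_, ξ, isCominuscule_of_isConstUpToSign_sqLength
    (isConstUpToSign_of_zsmul hχi (hξ ▸ hχ)) b hi ((mul_eq_left₀ hχi).mp (hval i).symm)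
    fun j hj hji ↦ ?_, hξ⟩
  exact (mul_eq_zero.mp ((hval j).symm.trans (hsupp j hj hji))).resolve_left hχi

theorem isQuasiConstant_iff_of_isSimplyConnected [Finite ι] (hP : IsSimple P)
    (hsc : IsSimplyConnected P) (χ : X) :
    IsQuasiConstant P χ ↔
      ∃ (m : ℤ) (ξ : X), (IsMinuscule P ξ ∨ IsCominuscule P ξ) ∧ χ = m • ξ := by
  have := Fintype.ofFinite ι
  rw [isQuasiConstant_iff_isConstUpToSign hP]
  constructor
  · rintro (h | h)
    · obtain ⟨m, ξ, hξ, rfl⟩ := exists_isMinuscule_of_isConstUpToSign_one hsc h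
      exact ⟨m, ξ, .inl hξ, rfl⟩
    · by_cases h0 : ∃ i, P.toLinearMap χ (P.coroot i) ≠ 0
      · obtain ⟨m, ξ, hξ, rfl⟩ := exists_isCominuscule_of_isConstUpToSign_sqLength hP hsc h h0
        exact ⟨m, ξ, .inr hξ, rfl⟩
      · push Not at h0
        exact ⟨1, χ, .inl fun i ↦ .inl (h0 i), (one_smul ℤ χ).symm⟩
  · rintro ⟨m, ξ, h | h, rfl⟩
    · exact .inl (isConstUpToSign_zsmul (isConstUpToSign_one_of_isMinuscule h) m)
    · exact .inr (isConstUpToSign_zsmul (isConstUpToSign_sqLength_of_isCominuscule h) m)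

end Main

end QuasiConstant

namespace LinAlgGroup

lemma finite_weights_of_commute {K k V : Type*} [Field k] [AddCommGroup V] [Module k V]
    [FiniteDimensional k V] {f : K → Module.End k V} (hf : ∀ s t, Commute (f s) (f t)) :
    {χ : K → k | ∃ v : V, v ≠ 0 ∧ ∀ t, f t v = χ t • v}.Finite := by
  refine (WellFoundedGT.finite_ne_bot_of_iSupIndep
    (Module.End.independent_iInf_maxGenEigenspace_of_forall_mapsTo f fun s t ↦
      Module.End.mapsTo_maxGenEigenspace_of_comm (hf t s))).subset ?_
  rintro χ ⟨v, hv, hχ⟩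
  refine (Submodule.ne_bot_iff _).mpr ⟨v, (Submodule.mem_iInf _).mpr fun t ↦ ?_, hv⟩
  exact (f t).genEigenspace_le_maximal _ 1
    (Module.End.mem_eigenspace_iff.mpr (hχ t))

variable {k : Type*} [Field k] {n : ℕ} {G : Subgroup (GL (Fin n) k)}

lemma CharGroup.hom_injective {T : MaximalTorus G} : Function.Injective (CharGroup.hom (T := T)) :=
  fun _ _ h ↦ Additive.toMul.injective (Subtype.ext h)

instance finite_roots (T : MaximalTorus G) : Finite (roots T) := by
  let conj (t : T.toSubgroup) : Module.End k (Matrix (Fin n) (Fin n) k) :=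
    LinearMap.mulLeft k (t : GL (Fin n) k).1 * LinearMap.mulRight k (t⁻¹ : GL (Fin n) k).1
  have hmul (s t : T.toSubgroup) : conj (s * t) = conj s * conj t := by
    ext1 A
    simp [conj, mul_assoc, Matrix.mul_inv_rev]
  have hcomm (s t : T.toSubgroup) : Commute (conj s) (conj t) := by
    rw [Commute, SemiconjBy, ← hmul, ← hmul, T.isTorus.mul_comm]
  refine Set.Finite.of_finite_image (f := fun (α : CharGroup T) t ↦ (α.hom t : k))
    ((finite_weights_of_commute hcomm).subset ?_) ?_
  · rintro - ⟨α, ⟨-, A, hA, -, hα⟩, rfl⟩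
    exact ⟨A, hA, fun t ↦ by simpa [conj, mul_assoc] using hα t⟩
  · intro α _ β _ h
    exact CharGroup.hom_injective (MonoidHom.ext fun t ↦ Units.ext (congrFun h t))

end LinAlgGroup

theorem theorem1p2p1_general {ι X Y : Type*} [Finite ι] [AddCommGroup X] [AddCommGroup Y]
    (P : RootDatum ι X Y) [P.IsReduced] (hsimple : RootDatum.IsSimple P) :
    (RootDatum.IsSimplyConnected P → ∀ χ : X, RootDatum.IsQuasiConstant P χ ↔
      ∃ (m : ℤ) (ξ : X),
        (RootDatum.IsMinuscule P ξ ∨ RootDatum.IsCominuscule P ξ) ∧ χ = m • ξ) ∧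
    (RootDatum.IsAdjoint P → ∀ μ : Y, RootDatum.IsQuasiConstant P.flip μ ↔
      ∃ (m : ℤ) (ν : Y),
        (RootDatum.IsMinuscule P.flip ν ∨ RootDatum.IsCominuscule P.flip ν) ∧ μ = m • ν) := by
  have := Module.IsReflexive.of_isPerfPair P.toLinearMap
  have := Module.IsReflexive.of_isPerfPair P.flip.toLinearMap
  exact ⟨QuasiConstant.isQuasiConstant_iff_of_isSimplyConnected hsimple, fun had ↦
    QuasiConstant.isQuasiConstant_iff_of_isSimplyConnected (P := P.flip)
      (QuasiConstant.isSimple_flip hsimple) had⟩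

theorem theorem1p2p1 {k : Type*} [Field k] [IsAlgClosed k] {n : ℕ}
    (G : Subgroup (GL (Fin n) k)) (hG : LinAlgGroup.IsConnectedReductive G)
    (T : LinAlgGroup.MaximalTorus G)
    (P : RootDatum (LinAlgGroup.roots T) (LinAlgGroup.CharGroup T) (LinAlgGroup.CocharGroup T))
    (hP : LinAlgGroup.IsRootDatum T P) (hsimple : RootDatum.IsSimple P) :
    (RootDatum.IsSimplyConnected P → ∀ χ : LinAlgGroup.CharGroup T,
      RootDatum.IsQuasiConstant P χ ↔
        ∃ (m : ℤ) (ξ : LinAlgGroup.CharGroup T),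
          (RootDatum.IsMinuscule P ξ ∨ RootDatum.IsCominuscule P ξ) ∧ χ = m • ξ) ∧
    (RootDatum.IsAdjoint P → ∀ μ : LinAlgGroup.CocharGroup T,
      RootDatum.IsQuasiConstant P.flip μ ↔
        ∃ (m : ℤ) (ν : LinAlgGroup.CocharGroup T),
          (RootDatum.IsMinuscule P.flip ν ∨ RootDatum.IsCominuscule P.flip ν) ∧ μ = m • ν) :=
  have := hP.isReduced
  theorem1p2p1_general P hsimple
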